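/- Conventions. Compact means quasi-compact and Hausdorff; a space is locally compact if every point has a compact neighborhood (it need not be Hausdorff). A topological groupoid $G$ with unit space $X$ has continuous structure maps, and its range and source maps $r,s:G\to X$ are open. Write $G_x=s^{-1}(x)$. $G$ is minimal if $\emptyset$ and $X$ are the only open subsets $U\subset X$ that are invariant (i.e. $s(\gamma)\in U\Rightarrow r(\gamma)\in U$ for all $\gamma\in G$). A (continuous) Hilbert bundle over $X$ is a topological space $E$ with a continuous open surjection $\pi:E\to X$ whose fibers $E_x=\pi^{-1}(x)$ are (complex or real) Hilbert spaces, such that (1) $u\mapsto\|u\|$ is continuous on $E$; (2) addition is continuous from $E*E=\{(u,v):\pi(u)=\pi(v)\}$ to $E$; (3) for each scalar $\lambda$, $u\mapsto\lambda u$ is continuous on $E$; (4) if $(u_i)$ is a net in $E$ with $\|u_i\|\to 0$ and $\pi(u_i)\to x$, then $u_i\to 0_x$, the zero element of $E_x$. A continuous $G$-Hilbert bundle is a Hilbert bundle $E$ over $X$ with an action of $G$, $(\gamma,u)\mapsto L(\gamma)u$, continuous from $G*E=\{(\gamma,u):s(\gamma)=\pi(u)\}$ to $E$, such that each $L(\gamma):E_{s(\gamma)}\to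 E_{r(\gamma)}$ is a linear isometry. A continuous cocycle $c:G\to r^*E$ is a continuous map $c: G\to E$ with $c(\gamma)\in E_{r(\gamma)}$ for all $\gamma$ and $c(\gamma\gamma')=c(\gamma)+L(\gamma)c(\gamma')$ for all composable $(\gamma,\gamma')$. The weak topology of $E$ (for $X$ locally compact Hausdorff) is the topology in which a point $(\underline x,\underline u)$, $\underline u\in E_{\underline x}$, has as a fundamental system of neighborhoods the sets $$\{(x,u): x\in V,\ |(f_i(x)|u)-(f_i(\underline x)|\underline u)|<\epsilon,\ i=1,\dots,n\},$$ where $V$ is a compact neighborhood of $\underline x$, $f_1,\dots,f_n:V\to E$ are continuous sections and $\epsilon>0$. A section $f:X\to E$ is weakly continuous if it is continuous for the weak topology of $E$. Theorem. Let $G$ be a minimal locally compact groupoid on a compact space $X$, let $E$ be a continuous $G$-Hilbert bundle and let $c:G\to r^*E$ be a continuous cocycle. If there exists $x\in X$ such that $\{\|c(\gamma)\|:\gamma\in G_x\}$ is bounded, then there exists a weakly continuous section $f:X\to E$ such that $$c(\gamma)=f(r(\gamma))-L(\gamma)f(s(\gamma))\qquad\text{for all }\gamma\in G.$$ -/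

import Mathlib

open CategoryTheory Bundle Topology Set

universe u v w k

/-! ### Topological groupoids with unit space `X`

The algebraic groupoid is a Mathlib `Groupoid X`. An element `γ` with source `x` and range `y`
is a morphism `x ⟶ y`, and the product `γ γ'` of groupoid elements (first `γ'`, then `γ`)
is `γ' ≫ γ`. -/

/-- The set `G` of all elements of a groupoid with unit space `X`. -/
structure GroupoidArrow (X : Type u) [Groupoid.{v} X] : Type (max u v) where
  /-- the source `s γ` -/
  src : X
  /-- the range `r γ` -/
  tgt : X
  /-- the element itself -/
  hom : src ⟶ tgt

/-- The set `G⁽²⁾` of composable pairs `(γ, γ')`, that is, with `s γ = r γ'`. -/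
structure ComposablePair (X : Type u) [Groupoid.{v} X] : Type (max u v) where
  /-- the source of `γ'` -/
  src : X
  /-- the range of `γ'`, which is the source of `γ` -/
  mid : X
  /-- the range of `γ` -/
  tgt : X
  /-- the element `γ` -/
  left : mid ⟶ tgt
  /-- the element `γ'` -/
  right : src ⟶ mid

/-- The composable pairs carry the subspace topology of `G × G`. -/
instance (X : Type u) [Groupoid.{v} X] [TopologicalSpace (GroupoidArrow X)] :
    TopologicalSpace (ComposablePair X) :=
  TopologicalSpace.induced
    (fun p => ((⟨p.mid, p.tgt, p.left⟩, ⟨p.src, p.mid, p.right⟩) :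
      GroupoidArrow X × GroupoidArrow X)) inferInstance

/-- A topological groupoid with unit space `X`: all structure maps are continuous, and the range
and source maps are open. The unit map `x ↦ 𝟙 x` is then a homeomorphism onto its image. -/
class IsTopologicalGroupoid (X : Type u) [TopologicalSpace X] [Groupoid.{v} X]
    [TopologicalSpace (GroupoidArrow X)] : Prop where
  continuous_src : Continuous fun γ : GroupoidArrow X => γ.src
  continuous_tgt : Continuous fun γ : GroupoidArrow X => γ.tgt
  isOpenMap_src : IsOpenMap fun γ : GroupoidArrow X => γ.src
  isOpenMap_tgt : IsOpenMap fun γ : GroupoidArrow X => γ.tgt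
  continuous_unit : Continuous fun x : X => (⟨x, x, 𝟙 x⟩ : GroupoidArrow X)
  continuous_inv : Continuous fun γ : GroupoidArrow X =>
    (⟨γ.tgt, γ.src, Groupoid.inv γ.hom⟩ : GroupoidArrow X)
  continuous_mul : Continuous fun p : ComposablePair X =>
    (⟨p.src, p.tgt, p.right ≫ p.left⟩ : GroupoidArrow X)

/-- Every element of `G` has a compact Hausdorff neighborhood (`G` itself need not be
Hausdorff). -/
def IsLocallyCompactGroupoid (X : Type u) [Groupoid.{v} X]
    [TopologicalSpace (GroupoidArrow X)] : Prop :=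
  ∀ γ : GroupoidArrow X, ∃ K ∈ 𝓝 γ, IsCompact K ∧ T2Space K

/-- The groupoid is minimal: `∅` and `X` are the only open invariant subsets of `X`. -/
def IsMinimalGroupoid (X : Type u) [TopologicalSpace X] [Groupoid.{v} X] : Prop :=
  ∀ U : Set X, IsOpen U → (∀ ⦃x y : X⦄, (x ⟶ y) → x ∈ U → y ∈ U) → U = ∅ ∨ U = univ

/-! ### Hilbert bundles -/

/-- The bundle space of a family `(E x)` of fibers. Its points are the pairs `(x, u)` with
`u ∈ E x`. The bundle projection is `TotalSpace.proj`. (The first argument of Mathlib's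
`TotalSpace` names a model fiber; it plays no role here.) -/
abbrev BundleSpace {X : Type u} (E : X → Type w) : Type (max u w) := TotalSpace Unit E

/-- A (continuous) Hilbert bundle over `X`: the fibers `E x` are Hilbert spaces and the bundle space
carries a topology such that the following holds. (Surjectivity of the projection is automatic.)
The fibered product `E * E` carries the subspace topology of `E × E`. -/
class IsHilbertBundle (𝕜 : Type k) [RCLike 𝕜] {X : Type u} [TopologicalSpace X] (E : X → Type w)
    [∀ x, NormedAddCommGroup (E x)] [∀ x, InnerProductSpace 𝕜 (E x)] [∀ x, CompleteSpace (E x)]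
    [TopologicalSpace (BundleSpace E)] : Prop where
  continuous_proj : Continuous fun p : BundleSpace E => p.proj
  isOpenMap_proj : IsOpenMap fun p : BundleSpace E => p.proj
  continuous_norm : Continuous fun p : BundleSpace E => ‖p.snd‖
  continuous_add : Continuous fun p : TotalSpace (Unit × Unit) (E ×ᵇ E) =>
    (⟨p.proj, p.snd.1 + p.snd.2⟩ : BundleSpace E)
  continuous_smul : ∀ a : 𝕜, Continuous fun p : BundleSpace E =>
    (⟨p.proj, a • p.snd⟩ : BundleSpace E)
  /-- If `‖uᵢ‖ → 0` and `π uᵢ → x` along a filter, then `uᵢ → 0` in the fiber over `x`. -/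
  tendsto_zero : ∀ x : X,
    Filter.comap (fun p : BundleSpace E => ‖p.snd‖) (𝓝 0) ⊓
      Filter.comap (fun p : BundleSpace E => p.proj) (𝓝 x) ≤ 𝓝 (⟨x, 0⟩ : BundleSpace E)

/-- A `G`-Hilbert bundle structure on a Hilbert bundle `E`: an action `L` of the groupoid by linear
isometries `L γ : E (s γ) → E (r γ)`, continuous as a map `G * E → E`. The space
`G * E = {(γ, u) | s γ = π u}` is the total space of the pullback of `E` along the source map, with
the subspace topology of `G × E`. -/
structure GHilbertBundle (𝕜 : Type k) [RCLike 𝕜] {X : Type u} [TopologicalSpace X]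
    [Groupoid.{v} X] [TopologicalSpace (GroupoidArrow X)] (E : X → Type w)
    [∀ x, NormedAddCommGroup (E x)] [∀ x, InnerProductSpace 𝕜 (E x)] [∀ x, CompleteSpace (E x)]
    [TopologicalSpace (BundleSpace E)] : Type (max u v w k) extends IsHilbertBundle 𝕜 E where
  /-- the linear isometry attached to an element of the groupoid -/
  L : ∀ {x y : X}, (x ⟶ y) → E x →ₗᵢ[𝕜] E y
  L_unit : ∀ (x : X) (u : E x), L (𝟙 x) u = u
  L_mul : ∀ {x y z : X} (γ : y ⟶ z) (γ' : x ⟶ y) (u : E x), L (γ' ≫ γ) u = L γ (L γ' u)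
  continuous_action : Continuous
    fun p : TotalSpace Unit ((fun γ : GroupoidArrow X => γ.src) *ᵖ E) =>
      (⟨p.proj.tgt, L p.proj.hom p.snd⟩ : BundleSpace E)

/-- A continuous cocycle `c : G → r^*E`: a section, `c γ ∈ E (r γ)`, with
`c (γ γ') = c γ + L γ (c γ')`, which is continuous into the pullback of `E` along the range map
(with the subspace topology of `G × E`). -/
structure ContinuousCocycle {𝕜 : Type k} [RCLike 𝕜] {X : Type u} [TopologicalSpace X]
    [Groupoid.{v} X] [TopologicalSpace (GroupoidArrow X)] {E : X → Type w}
    [∀ x, NormedAddCommGroup (E x)] [∀ x, InnerProductSpace 𝕜 (E x)] [∀ x, CompleteSpace (E x)]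
    [TopologicalSpace (BundleSpace E)] (B : GHilbertBundle.{u, v, w, k} 𝕜 E) :
    Type (max u v w) where
  /-- the values of the cocycle -/
  c : ∀ {x y : X}, (x ⟶ y) → E y
  map_mul : ∀ {x y z : X} (γ : y ⟶ z) (γ' : x ⟶ y), c (γ' ≫ γ) = c γ + B.L γ (c γ')
  continuous_section : Continuous fun γ : GroupoidArrow X =>
    (⟨γ, c γ.hom⟩ : TotalSpace Unit ((fun γ : GroupoidArrow X => γ.tgt) *ᵖ E))

/-! ### The weak topology of the bundle space -/

section Weak

variable (𝕜 : Type k) [RCLike 𝕜] {X : Type u} [TopologicalSpace X] {E : X → Type w}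
  [∀ x, NormedAddCommGroup (E x)] [∀ x, InnerProductSpace 𝕜 (E x)]
  [TopologicalSpace (BundleSpace E)]

/-- The set `U(V; f₁, …, fₙ; ε)` around the point `p`, with `F = {f₁, …, fₙ}`. -/
def weakBasicNhd (p : BundleSpace E) (V : Set X) (F : Set (∀ x, E x)) (ε : ℝ) :
    Set (BundleSpace E) :=
  {q | q.proj ∈ V ∧ ∀ f ∈ F, ‖inner 𝕜 (f q.proj) q.snd - inner 𝕜 (f p.proj) p.snd‖ < ε}

/-- The admissible data for a weak basic neighborhood of a point over `x`: a compact neighborhood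
`V` of `x`, a finite set `F` of sections that are continuous on `V` (their values outside `V` are
irrelevant), and `ε > 0`. -/
def IsWeakNhdDatum (x : X) (d : Set X × Set (∀ x, E x) × ℝ) : Prop :=
  d.1 ∈ 𝓝 x ∧ IsCompact d.1 ∧ d.2.1.Finite ∧
    (∀ f ∈ d.2.1, ContinuousOn (fun y => (⟨y, f y⟩ : BundleSpace E)) d.1) ∧ 0 < d.2.2

variable [T2Space X] [LocallyCompactSpace X] (E)

/-- The weak topology of the bundle space `E`, for which the sets `U(V; f₁, …, fₙ; ε)` around `p`
form a fundamental system of neighborhoods of `p`: see `nhds_weakTopology_hasBasis`. -/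
@[reducible] def weakTopology : TopologicalSpace (BundleSpace E) where
  IsOpen S := ∀ p ∈ S, ∃ d : Set X × Set (∀ x, E x) × ℝ,
    IsWeakNhdDatum p.proj d ∧ weakBasicNhd 𝕜 p d.1 d.2.1 d.2.2 ⊆ S
  isOpen_univ := by
    intro p _
    obtain ⟨V, hV, hp⟩ := exists_compact_mem_nhds p.proj
    exact ⟨(V, ∅, 1), ⟨hp, hV, finite_empty, by simp, one_pos⟩, subset_univ _⟩
  isOpen_inter := by
    rintro S T hS hT p ⟨hpS, hpT⟩
    obtain ⟨⟨V, F, ε⟩, ⟨h1, h2, h3, h4, h5⟩, hd⟩ := hS p hpS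
    obtain ⟨⟨V', F', ε'⟩, ⟨h1', h2', h3', h4', h5'⟩, hd'⟩ := hT p hpT
    refine ⟨(V ∩ V', F ∪ F', min ε ε'), ⟨Filter.inter_mem h1 h1', h2.inter h2', h3.union h3', ?_,
      lt_min h5 h5'⟩, ?_⟩
    · rintro f (hf | hf)
      · exact (h4 f hf).mono inter_subset_left
      · exact (h4' f hf).mono inter_subset_right
    · rintro q ⟨hq, hqF⟩
      exact ⟨hd ⟨hq.1, fun f hf => (hqF f (Or.inl hf)).trans_le (min_le_left _ _)⟩,
        hd' ⟨hq.2, fun f hf => (hqF f (Or.inr hf)).trans_le (min_le_right _ _)⟩⟩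
  isOpen_sUnion := by
    intro 𝒮 h p ⟨S, hS, hp⟩
    obtain ⟨d, hd, hdS⟩ := h S hS p hp
    exact ⟨d, hd, hdS.trans (subset_sUnion_of_mem hS)⟩

/-- The sets `U(V; f₁, …, fₙ; ε)` around `p` form a fundamental system of neighborhoods of `p`. -/
theorem nhds_weakTopology_hasBasis (p : BundleSpace E) :
    (@nhds (BundleSpace E) (weakTopology 𝕜 E) p).HasBasis
      (IsWeakNhdDatum p.proj) (fun d => weakBasicNhd 𝕜 p d.1 d.2.1 d.2.2) := by
  constructor
  intro S
  refine Iff.trans (@mem_nhds_iff _ (weakTopology 𝕜 E) _ _) ?_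
  constructor
  · rintro ⟨T, hTS, hT, hp⟩
    obtain ⟨d, hd, hdT⟩ := hT p hp
    exact ⟨d, hd, hdT.trans hTS⟩
  · rintro ⟨⟨V, F, ε⟩, ⟨h1, h2, h3, h4, h5⟩, hd⟩
    refine ⟨weakBasicNhd 𝕜 p (interior V) F ε, ?_, ?_, ?_⟩
    · exact fun q hq => hd ⟨interior_subset hq.1, hq.2⟩
    · rintro q ⟨hq, hqF⟩
      obtain ⟨K, hK, hqK, hKV⟩ := exists_compact_subset isOpen_interior hq
      obtain ⟨δ, hδ, hδF⟩ : ∃ δ : ℝ, 0 < δ ∧ ∀ f ∈ F,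
          ‖inner 𝕜 (f q.proj) q.snd - inner 𝕜 (f p.proj) p.snd‖ + δ ≤ ε := by
        rcases F.eq_empty_or_nonempty with rfl | hne
        · exact ⟨1, one_pos, by simp⟩
        · obtain ⟨g, hg, hgmax⟩ := Set.exists_max_image F
            (fun f => ‖inner 𝕜 (f q.proj) q.snd - inner 𝕜 (f p.proj) p.snd‖) h3 hne
          refine ⟨ε - ‖inner 𝕜 (g q.proj) q.snd - inner 𝕜 (g p.proj) p.snd‖,
            sub_pos.2 (hqF g hg), fun f hf => ?_⟩
          have := hgmax f hf
          linarith
      refine ⟨(K, F, δ), ⟨mem_interior_iff_mem_nhds.1 hqK, hK, h3,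
        fun f hf => (h4 f hf).mono (hKV.trans interior_subset), hδ⟩, ?_⟩
      rintro t ⟨htK, htF⟩
      refine ⟨hKV htK, fun f hf => ?_⟩
      have e1 := htF f hf
      have e2 := hδF f hf
      have e3 := norm_sub_le_norm_sub_add_norm_sub (inner 𝕜 (f t.proj) t.snd)
        (inner 𝕜 (f q.proj) q.snd) (inner 𝕜 (f p.proj) p.snd)
      linarith
    · exact ⟨mem_interior_iff_mem_nhds.2 h1, by simpa using fun _ _ => h5⟩

variable {E}

/-- A section `f : X → E` is weakly continuous if it is continuous for the weak topology of the
bundle space. -/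
def IsWeaklyContinuousSection (f : ∀ x, E x) : Prop :=
  @Continuous X (BundleSpace E) _ (weakTopology 𝕜 E) (fun x => ⟨x, f x⟩)

end Weak

/-! The groupoid acts on `E` by the affine isometries `u ↦ L γ u + c γ`, and the cocycle identity
says that they permute the values of `c`. A section solves the equation exactly when it is
equivariant for this action, so a canonical center of the values in each fiber is needed.

Consider dyadic probability measures on the values over `y`, recorded only by barycenter `u` and
second moment `s`; the variance is `s - ‖u‖ ^ 2`. It is bounded because `c` is, preserved by the
affine action (`Moment.exists_map`), and its supremum is the same over every point by minimality
(`exists_moment_variance_gt`). Averaging two measures adds `‖u - v‖ ^ 2 / 4` to their mean variance,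
so measures of nearly maximal variance have nearby barycenters. Their limit `f y` is equivariant by
construction.

The estimate is uniform in `y`, and each measure deforms to nearby fibers because the range map is
open (`Moment.eventually_exists`). Thus barycenters approximate `f` well enough for weak continuity.
-/

section

variable {𝕜 : Type k} [RCLike 𝕜] {X : Type u} [TopologicalSpace X]

/-- In a minimal groupoid with open range map every orbit meets every nonempty open set. -/
theorem IsMinimalGroupoid.exists_hom [Groupoid.{v} X] [TopologicalSpace (GroupoidArrow X)]
    [IsTopologicalGroupoid X] (hmin : IsMinimalGroupoid X) {U : Set X} (hU : IsOpen U)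
    (hne : U.Nonempty) (x : X) : ∃ z ∈ U, Nonempty (z ⟶ x) := by
  have hopen : IsOpen ((fun γ : GroupoidArrow X => γ.tgt) '' {γ | γ.src ∈ U}) :=
    IsTopologicalGroupoid.isOpenMap_tgt _ (hU.preimage IsTopologicalGroupoid.continuous_src)
  rcases hmin _ hopen (by
    rintro y z η ⟨γ, hγ, rfl⟩
    exact ⟨⟨γ.src, z, γ.hom ≫ η⟩, hγ, rfl⟩) with h | h
  · obtain ⟨z, hz⟩ := hne
    have : z ∈ (fun γ : GroupoidArrow X => γ.tgt) '' {γ | γ.src ∈ U} := ⟨⟨z, z, 𝟙 z⟩, hz, rfl⟩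
    rw [h] at this
    exact this.elim
  · obtain ⟨γ, hγ, rfl⟩ : x ∈ (fun γ : GroupoidArrow X => γ.tgt) '' {γ | γ.src ∈ U} := by
      rw [h]
      trivial
    exact ⟨γ.src, hγ, ⟨γ.hom⟩⟩

variable {E : X → Type w} [∀ x, NormedAddCommGroup (E x)] [∀ x, InnerProductSpace 𝕜 (E x)]
  [∀ x, CompleteSpace (E x)] [TopologicalSpace (BundleSpace E)]

/-! ### Joint continuity in Hilbert bundles -/

namespace IsHilbertBundle

/-- Linear combinations are continuous on the fibered product `E * E`. -/
theorem continuous_linearCombination (hE : IsHilbertBundle 𝕜 E) (a b : 𝕜) :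
    Continuous fun p : TotalSpace (Unit × Unit) (E ×ᵇ E) =>
      (⟨p.proj, a • p.snd.1 + b • p.snd.2⟩ : BundleSpace E) := by
  have hind : IsInducing fun p : TotalSpace (Unit × Unit) (E ×ᵇ E) =>
      ((⟨p.proj, p.snd.1⟩, ⟨p.proj, p.snd.2⟩) : BundleSpace E × BundleSpace E) := ⟨rfl⟩
  have h : Continuous fun p : TotalSpace (Unit × Unit) (E ×ᵇ E) =>
      (⟨p.proj, (a • p.snd.1, b • p.snd.2)⟩ : TotalSpace (Unit × Unit) (E ×ᵇ E)) := by
    rw [hind.continuous_iff]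
    exact ((hE.continuous_smul a).comp (continuous_fst.comp hind.continuous)).prodMk
      ((hE.continuous_smul b).comp (continuous_snd.comp hind.continuous))
  exact hE.continuous_add.comp h

/-- The inner product is continuous on the fibered product `E * E`. -/
theorem continuous_inner (hE : IsHilbertBundle 𝕜 E) :
    Continuous fun p : TotalSpace (Unit × Unit) (E ×ᵇ E) => inner 𝕜 p.snd.1 p.snd.2 := by
  have h (b : 𝕜) : Continuous fun p : TotalSpace (Unit × Unit) (E ×ᵇ E) =>
      ((‖p.snd.1 + b • p.snd.2‖ : ℝ) : 𝕜) := by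
    have := hE.continuous_norm.comp (hE.continuous_linearCombination 1 b)
    simp only [Function.comp_def, one_smul] at this
    exact RCLike.continuous_ofReal.comp this
  have h1 := h 1
  have h2 := h (-1)
  have h3 := h RCLike.I
  have h4 := h (-RCLike.I)
  simp only [one_smul, neg_smul, ← sub_eq_add_neg] at h1 h2 h3 h4
  -- Polarization reduces the inner product to norms of linear combinations.
  simp only [inner_eq_sum_norm_sq_div_four]
  fun_prop

set_option linter.unusedSectionVars false in
/-- The pairs over `x` near `(u, v)` are the pairs of points over `x` near `u` and `v`. -/
theorem exists_nhds_of_mem_nhds_prod {x : X} {u v : E x}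
    {W : Set (TotalSpace (Unit × Unit) (E ×ᵇ E))}
    (hW : W ∈ 𝓝 (⟨x, (u, v)⟩ : TotalSpace (Unit × Unit) (E ×ᵇ E))) :
    ∃ S ∈ 𝓝 (⟨x, u⟩ : BundleSpace E), ∃ T ∈ 𝓝 (⟨x, v⟩ : BundleSpace E),
      ∀ (y : X) (u' v' : E y), (⟨y, u'⟩ : BundleSpace E) ∈ S → (⟨y, v'⟩ : BundleSpace E) ∈ T →
        (⟨y, (u', v')⟩ : TotalSpace (Unit × Unit) (E ×ᵇ E)) ∈ W := by
  have hind : IsInducing fun p : TotalSpace (Unit × Unit) (E ×ᵇ E) =>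
      ((⟨p.proj, p.snd.1⟩, ⟨p.proj, p.snd.2⟩) : BundleSpace E × BundleSpace E) := ⟨rfl⟩
  rw [hind.nhds_eq_comap, Filter.mem_comap] at hW
  obtain ⟨t, ht, htW⟩ := hW
  obtain ⟨S, hS, T, hT, h⟩ := mem_nhds_prod_iff.1 ht
  exact ⟨S, hS, T, hT, fun y u' v' hu hv => htW (h ⟨hu, hv⟩)⟩

end IsHilbertBundle

/-! ### A criterion for weak continuity -/

/-- A section which is uniformly approximated by lower hemicontinuous families of vectors is weakly
continuous. -/
theorem isWeaklyContinuousSection_of_approx [T2Space X] [LocallyCompactSpace X]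
    (hE : IsHilbertBundle 𝕜 E) {f : ∀ x, E x}
    (hf : ∀ x : X, ∀ δ > 0, ∃ u : E x, ‖u - f x‖ ≤ δ ∧ ∀ W ∈ 𝓝 (⟨x, u⟩ : BundleSpace E),
      ∀ᶠ y in 𝓝 x, ∃ v : E y, ‖v - f y‖ ≤ δ ∧ (⟨y, v⟩ : BundleSpace E) ∈ W) :
    IsWeaklyContinuousSection 𝕜 f := by
  refine (@continuous_iff_continuousAt _ _ _ (weakTopology 𝕜 E) _).2 fun x => ?_
  refine (nhds_weakTopology_hasBasis 𝕜 E _).tendsto_right_iff.2 ?_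
  rintro ⟨V, F, ε⟩ ⟨hV, -, hF, hFc, hε⟩
  refine Filter.Eventually.and hV ((Filter.eventually_all_finite hF).2 fun g hg => ?_)
  have hgx : ContinuousAt (fun y => (⟨y, g y⟩ : BundleSpace E)) x :=
    (hFc g hg).continuousAt hV
  have hε : 0 < ε := hε
  -- `A` bounds `‖g‖` near `x`, so replacing `f` by an approximant within `ε / (4 * A)` costs at
  -- most `ε / 4` at each of `x` and `y`; continuity of the inner product gets the remaining `ε /
  -- 2`.
  set A : ℝ := ‖g x‖ + 1 with hA
  have hA0 : 0 < A := by positivity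
  obtain ⟨u, hu, hW⟩ := hf x (ε / (4 * A)) (by positivity)
  obtain ⟨S, hS, T, hT, hST⟩ := IsHilbertBundle.exists_nhds_of_mem_nhds_prod
    (hE.continuous_inner.continuousAt (x := ⟨x, (g x, u)⟩)
      (Metric.ball_mem_nhds _ (half_pos hε)))
  have hnorm : ∀ᶠ y in 𝓝 x, ‖g y‖ < A :=
    (hE.continuous_norm.continuousAt.comp hgx).eventually_lt_const (lt_add_one ‖g x‖)
  filter_upwards [hgx hS, hnorm, hW T hT]
  rintro y hy hyA ⟨v, hv, hvT⟩
  have h1 : ‖inner 𝕜 (g y) v - inner 𝕜 (g x) u‖ < ε / 2 := by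
    simpa [dist_eq_norm] using hST y (g y) v hy hvT
  have h2 : ‖inner 𝕜 (g y) (v - f y)‖ ≤ ε / 4 := by
    calc _ ≤ ‖g y‖ * ‖v - f y‖ := norm_inner_le_norm _ _
      _ ≤ A * (ε / (4 * A)) := by gcongr
      _ = ε / 4 := by field_simp
  have h3 : ‖inner 𝕜 (g x) (u - f x)‖ ≤ ε / 4 := by
    calc _ ≤ ‖g x‖ * ‖u - f x‖ := norm_inner_le_norm _ _
      _ ≤ A * (ε / (4 * A)) := by
        gcongr
        linarith
      _ = ε / 4 := by field_simp
  have h4 : inner 𝕜 (g y) (f y) - inner 𝕜 (g x) (f x) = (inner 𝕜 (g y) v - inner 𝕜 (g x) u) -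
      inner 𝕜 (g y) (v - f y) + inner 𝕜 (g x) (u - f x) := by
    rw [inner_sub_right, inner_sub_right]
    ring
  change ‖inner 𝕜 (g y) (f y) - inner 𝕜 (g x) (f x)‖ < ε
  rw [h4]
  have h5 := norm_add_le (inner 𝕜 (g y) v - inner 𝕜 (g x) u - inner 𝕜 (g y) (v - f y))
    (inner 𝕜 (g x) (u - f x))
  have h6 := norm_sub_le (inner 𝕜 (g y) v - inner 𝕜 (g x) u) (inner 𝕜 (g y) (v - f y))
  linarith

/-! ### Moments of the cocycle values -/

/-- The square of the norm of a midpoint. -/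
theorem norm_sq_midpoint {F : Type w} [NormedAddCommGroup F] [InnerProductSpace 𝕜 F] (u v : F) :
    ‖(2⁻¹ : 𝕜) • u + (2⁻¹ : 𝕜) • v‖ ^ 2 = (‖u‖ ^ 2 + ‖v‖ ^ 2) / 2 - ‖u - v‖ ^ 2 / 4 := by
  have h := parallelogram_law_with_norm 𝕜 u v
  rw [← smul_add, norm_smul, norm_inv, RCLike.norm_ofNat]
  ring_nf
  nlinarith

variable [Groupoid.{v} X] [TopologicalSpace (GroupoidArrow X)]
  {B : GHilbertBundle.{u, v, w, k} 𝕜 E}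

namespace ContinuousCocycle

/-- `c.Moment u s` says that `u ∈ E y` is the barycenter and `s` the second moment of a dyadic
probability measure with finite support in the set of values of `c` in `E y`. -/
inductive Moment (c : ContinuousCocycle B) : ∀ {y : X}, E y → ℝ → Prop
  | value {x y : X} (γ : x ⟶ y) : Moment c (c.c γ) (‖c.c γ‖ ^ 2)
  | mid {y : X} {u v : E y} {s t : ℝ} (hu : Moment c u s) (hv : Moment c v t) :
      Moment c ((2⁻¹ : 𝕜) • u + (2⁻¹ : 𝕜) • v) ((s + t) / 2)

variable (c : ContinuousCocycle B)

theorem continuous_value : Continuous fun γ : GroupoidArrow X =>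
    (⟨γ.tgt, c.c γ.hom⟩ : BundleSpace E) :=
  (Pullback.continuous_lift Unit E fun γ : GroupoidArrow X => γ.tgt).comp c.continuous_section

/-- A continuous cocycle of a minimal groupoid which is bounded on one source fiber is bounded. -/
theorem exists_norm_le [IsTopologicalGroupoid X] (hmin : IsMinimalGroupoid X)
    (hc : ∃ x : X, ∃ M : ℝ, ∀ (y : X) (γ : x ⟶ y), ‖c.c γ‖ ≤ M) :
    ∃ C : ℝ, ∀ (x y : X) (γ : x ⟶ y), ‖c.c γ‖ ≤ C := by
  obtain ⟨x, M, hM⟩ := hc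
  -- If `‖c η‖ > 2 * M` somewhere, minimality lets the source of such an `η` be joined to `x`; then
  -- `c η` is a difference of two vectors of norm at most `M`.
  refine ⟨2 * M, fun y z γ => ?_⟩
  by_contra! hγ
  have hopen : IsOpen ((fun γ : GroupoidArrow X => γ.src) '' {γ | 2 * M < ‖c.c γ.hom‖}) :=
    IsTopologicalGroupoid.isOpenMap_src _ (isOpen_lt continuous_const
      (B.continuous_norm.comp c.continuous_value))
  obtain ⟨_, ⟨η, hη, rfl⟩, ⟨ζ⟩⟩ := hmin.exists_hom hopen ⟨y, ⟨y, z, γ⟩, hγ, rfl⟩ x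
  have h1 := hM _ (Groupoid.inv ζ ≫ η.hom)
  have h2 := hM _ (Groupoid.inv ζ)
  rw [c.map_mul] at h1
  have h3 := norm_sub_le (c.c η.hom + B.L η.hom (c.c (Groupoid.inv ζ)))
    (B.L η.hom (c.c (Groupoid.inv ζ)))
  rw [add_sub_cancel_right, LinearIsometry.norm_map] at h3
  have h4 : 2 * M < ‖c.c η.hom‖ := hη
  linarith

variable {c}

theorem Moment.le_sq {C : ℝ} (hC : ∀ (x y : X) (γ : x ⟶ y), ‖c.c γ‖ ≤ C) {y : X} {u : E y} {s : ℝ}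
    (h : c.Moment u s) : s ≤ C ^ 2 := by
  induction h with
  | value γ => exact pow_le_pow_left₀ (norm_nonneg _) (hC _ _ γ) 2
  | mid _ _ h1 h2 => linarith

/-- The affine action of the groupoid transports moments. -/
theorem Moment.map {x y : X} (γ : x ⟶ y) {u : E x} {s : ℝ} (h : c.Moment u s) :
    c.Moment (B.L γ u + c.c γ) (s + 2 * RCLike.re (inner 𝕜 (B.L γ u) (c.c γ)) + ‖c.c γ‖ ^ 2) := by
  induction h with
  | value η =>
    have := Moment.value (c := c) (η ≫ γ)
    rw [c.map_mul, add_comm (c.c γ), @norm_add_sq 𝕜, LinearIsometry.norm_map] at this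
    exact this
  | @mid y u v s t _ _ h1 h2 =>
    -- Both transported quantities are affine in `(u, s)`, hence commute with midpoints.
    convert (h1 γ).mid (h2 γ) using 1
    · have h : c.c γ = (2⁻¹ : 𝕜) • c.c γ + (2⁻¹ : 𝕜) • c.c γ := by
        rw [← add_smul, ← two_mul, mul_inv_cancel₀ two_ne_zero, one_smul]
      rw [map_add, map_smul, map_smul, smul_add, smul_add]
      conv_lhs => rw [h]
      abel
    · have h2 (z : 𝕜) : RCLike.re ((2⁻¹ : 𝕜) * z) = RCLike.re z / 2 := by
        have : (2⁻¹ : 𝕜) = ((2⁻¹ : ℝ) : 𝕜) := by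
          rw [RCLike.ofReal_inv, RCLike.ofReal_ofNat]
        rw [this, RCLike.re_ofReal_mul]
        ring
      rw [map_add, map_smul, map_smul, inner_add_left, inner_smul_left, inner_smul_left, map_inv₀,
        RCLike.conj_ofNat, map_add, h2, h2]
      ring

/-- Affine isometries preserve variance. -/
theorem Moment.exists_map {x y : X} (γ : x ⟶ y) {u : E x} {s : ℝ} (h : c.Moment u s) :
    ∃ t, c.Moment (B.L γ u + c.c γ) t ∧ t - ‖B.L γ u + c.c γ‖ ^ 2 = s - ‖u‖ ^ 2 := by
  refine ⟨_, h.map γ, ?_⟩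
  rw [@norm_add_sq 𝕜, LinearIsometry.norm_map]
  ring

/-- Moments at a point can be approximated by moments at nearby points. -/
theorem Moment.eventually_exists [IsTopologicalGroupoid X] {x : X} {u : E x} {s : ℝ}
    (h : c.Moment u s) : ∀ W ∈ 𝓝 ((⟨x, u⟩, s) : BundleSpace E × ℝ),
      ∀ᶠ y in 𝓝 x, ∃ (v : E y) (t : ℝ), c.Moment v t ∧ ((⟨y, v⟩, t) : BundleSpace E × ℝ) ∈ W := by
  induction h with
  | @value z x γ =>
    intro W hW
    have hcont : Continuous fun η : GroupoidArrow X =>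
        ((⟨η.tgt, c.c η.hom⟩, ‖c.c η.hom‖ ^ 2) : BundleSpace E × ℝ) :=
      c.continuous_value.prodMk ((B.continuous_norm.comp c.continuous_value).pow 2)
    have h1 := hcont.continuousAt (x := (⟨z, x, γ⟩ : GroupoidArrow X)) hW
    -- Openness of the range map gives every `y` near `x` an arrow close to `γ` ending at `y`.
    have h2 := IsTopologicalGroupoid.isOpenMap_tgt.image_mem_nhds h1
    filter_upwards [h2]
    rintro y ⟨η, hη, rfl⟩
    exact ⟨_, _, Moment.value η.hom, hη⟩
  | @mid x u v s t _ _ h1 h2 =>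
    intro W hW
    obtain ⟨P, hP, Q, hQ, hPQ⟩ := mem_nhds_prod_iff.1 hW
    obtain ⟨S, hS, T, hT, hST⟩ := IsHilbertBundle.exists_nhds_of_mem_nhds_prod
      ((B.continuous_linearCombination 2⁻¹ 2⁻¹).continuousAt (x := ⟨x, (u, v)⟩) hP)
    have hcont : Continuous fun p : ℝ × ℝ => (p.1 + p.2) / 2 := by fun_prop
    obtain ⟨S', hS', T', hT', hST'⟩ := mem_nhds_prod_iff.1
      (hcont.continuousAt (x := (s, t)) hQ)
    filter_upwards [h1 _ (prod_mem_nhds hS hS'), h2 _ (prod_mem_nhds hT hT')]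
    rintro y ⟨u', s', hu', hu1, hu2⟩ ⟨v', t', hv', hv1, hv2⟩
    exact ⟨_, _, hu'.mid hv', hPQ ⟨hST y u' v' hu1 hv1, hST' (⟨hu2, hv2⟩ : (s', t') ∈ S' ×ˢ T')⟩⟩

/-! ### Maximal variance -/

variable (c)

/-- If the groupoid is minimal, then every variance that occurs over some point is exceeded, up to
an arbitrarily small error, over all points. -/
theorem exists_moment_variance_gt [IsTopologicalGroupoid X] (hmin : IsMinimalGroupoid X) {r : ℝ}
    {x : X} {u : E x} {s : ℝ} (h : c.Moment u s) (hr : r < s - ‖u‖ ^ 2) (y : X) :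
    ∃ (v : E y) (t : ℝ), c.Moment v t ∧ r < t - ‖v‖ ^ 2 := by
  have hopen : IsOpen {y : X | ∃ (v : E y) (t : ℝ), c.Moment v t ∧ r < t - ‖v‖ ^ 2} := by
    rw [isOpen_iff_mem_nhds]
    rintro y ⟨v, t, hv, hvt⟩
    have hW : IsOpen {p : BundleSpace E × ℝ | r < p.2 - ‖p.1.snd‖ ^ 2} :=
      isOpen_lt continuous_const
        (continuous_snd.sub ((B.continuous_norm.comp continuous_fst).pow 2))
    exact hv.eventually_exists _ (hW.mem_nhds hvt)
  obtain ⟨z, ⟨v, t, hv, hvt⟩, ⟨γ⟩⟩ := hmin.exists_hom hopen ⟨x, u, s, h, hr⟩ y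
  obtain ⟨t', h1, h2⟩ := hv.exists_map γ
  exact ⟨_, t', h1, by rwa [h2]⟩

/-- Barycenters of measures of almost maximal variance converge. -/
theorem exists_limit_barycenter {V : ℝ} {x : X}
    (hle : ∀ (u : E x) (s : ℝ), c.Moment u s → s - ‖u‖ ^ 2 ≤ V)
    (hex : ∀ δ > 0, ∃ (u : E x) (s : ℝ), c.Moment u s ∧ V - δ < s - ‖u‖ ^ 2) :
    ∃ a : E x, ∀ δ > 0, ∀ (u : E x) (s : ℝ), c.Moment u s → V - δ ^ 2 < s - ‖u‖ ^ 2 →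
      ‖u - a‖ ≤ 2 * δ := by
  have key : ∀ δ > 0, ∀ (u v : E x) (s t : ℝ), c.Moment u s → c.Moment v t →
      V - δ ^ 2 < s - ‖u‖ ^ 2 → V - δ ^ 2 < t - ‖v‖ ^ 2 → ‖u - v‖ ≤ 2 * δ := by
    intro δ hδ u v s t hu hv h1 h2
    -- The midpoint has variance greater than `V - δ ^ 2 + ‖u - v‖ ^ 2 / 4`, yet at most `V`.
    have h3 := hle _ _ (hu.mid hv)
    rw [norm_sq_midpoint] at h3
    exact (pow_le_pow_iff_left₀ (norm_nonneg _) (by positivity) two_ne_zero).1 (by linarith)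
  have hpos (n : ℕ) : (0 : ℝ) < 1 / (n + 1) := Nat.one_div_pos_of_nat
  choose a s ha has using fun n : ℕ => hex ((1 / (n + 1) : ℝ) ^ 2) (pow_pos (hpos n) 2)
  have has' {n : ℕ} {δ : ℝ} (hδ : (1 / (n + 1) : ℝ) ≤ δ) : V - δ ^ 2 < s n - ‖a n‖ ^ 2 := by
    have := pow_le_pow_left₀ (hpos n).le hδ 2
    linarith [has n]
  have hcauchy : CauchySeq a := by
    refine cauchySeq_of_le_tendsto_0 (fun N : ℕ => 2 * (1 / (N + 1) : ℝ)) (fun n m N hn hm => ?_) ?_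
    · rw [dist_eq_norm]
      exact key _ (hpos N) _ _ _ _ (ha n) (ha m) (has' (Nat.one_div_le_one_div hn))
        (has' (Nat.one_div_le_one_div hm))
    · simpa using tendsto_one_div_add_atTop_nhds_zero_nat.const_mul (2 : ℝ)
  obtain ⟨b, hb⟩ := cauchySeq_tendsto_of_complete hcauchy
  refine ⟨b, fun δ hδ u t hu hut => le_of_tendsto (hb.const_sub u).norm ?_⟩
  filter_upwards [tendsto_one_div_add_atTop_nhds_zero_nat.eventually_le_const hδ] with n hn
  exact key δ hδ _ _ _ _ hu (ha n) hut (has' hn)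

end ContinuousCocycle

end

/-! ### The equivariant section -/

theorem mainTheorem2 {𝕜 : Type k} [RCLike 𝕜]
    {X : Type u} [TopologicalSpace X] [CompactSpace X] [T2Space X]
    [Groupoid.{v} X] [TopologicalSpace (GroupoidArrow X)] [IsTopologicalGroupoid X]
    (hG : IsLocallyCompactGroupoid X) (hmin : IsMinimalGroupoid X)
    {E : X → Type w} [∀ x, NormedAddCommGroup (E x)] [∀ x, InnerProductSpace 𝕜 (E x)]
    [∀ x, CompleteSpace (E x)] [TopologicalSpace (BundleSpace E)]
    (B : GHilbertBundle.{u, v, w, k} 𝕜 E) (c : ContinuousCocycle B)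
    (hc : ∃ x : X, ∃ M : ℝ, ∀ (y : X) (γ : x ⟶ y), ‖c.c γ‖ ≤ M) :
    ∃ f : ∀ x, E x, IsWeaklyContinuousSection 𝕜 f ∧
      ∀ (x y : X) (γ : x ⟶ y), c.c γ = f y - B.L γ (f x) := by
  obtain ⟨C, hC⟩ := c.exists_norm_le hmin hc
  obtain ⟨x₀, -⟩ := hc
  let D : Set ℝ := {r | ∃ (x : X) (u : E x) (s : ℝ), c.Moment u s ∧ r = s - ‖u‖ ^ 2}
  have hD : BddAbove D := by
    refine ⟨C ^ 2, ?_⟩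
    rintro _ ⟨x, u, s, hu, rfl⟩
    linarith [hu.le_sq hC, sq_nonneg ‖u‖]
  have hne : D.Nonempty := ⟨_, x₀, _, _, ContinuousCocycle.Moment.value (𝟙 x₀), rfl⟩
  have hle (x : X) (u : E x) (s : ℝ) (hu : c.Moment u s) : s - ‖u‖ ^ 2 ≤ sSup D :=
    le_csSup hD ⟨x, u, s, hu, rfl⟩
  have hex (x : X) (δ : ℝ) (hδ : 0 < δ) :
      ∃ (u : E x) (s : ℝ), c.Moment u s ∧ sSup D - δ < s - ‖u‖ ^ 2 := by
    obtain ⟨_, ⟨z, v, t, hv, rfl⟩, ht⟩ := exists_lt_of_lt_csSup hne (sub_lt_self (sSup D) hδ)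
    exact c.exists_moment_variance_gt hmin hv ht x
  choose f hf using fun x => c.exists_limit_barycenter (hle x) (hex x)
  refine ⟨f, isWeaklyContinuousSection_of_approx B.toIsHilbertBundle fun x δ hδ => ?_,
    fun x y γ => ?_⟩
  · have hδ2 : 0 < δ / 2 := half_pos hδ
    have hfδ (y : X) (v : E y) (t : ℝ) (hv : c.Moment v t)
        (ht : sSup D - (δ / 2) ^ 2 < t - ‖v‖ ^ 2) : ‖v - f y‖ ≤ δ := by
      linarith [hf y _ hδ2 v t hv ht]
    obtain ⟨u, s, hu, hus⟩ := hex x _ (pow_pos hδ2 2)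
    refine ⟨u, hfδ x u s hu hus, fun W hW => ?_⟩
    -- The variance bound is an open condition, so deformed measures still have barycenters
    -- `δ`-close to `f`.
    have hopen : IsOpen {p : BundleSpace E × ℝ | sSup D - (δ / 2) ^ 2 < p.2 - ‖p.1.snd‖ ^ 2} :=
      isOpen_lt continuous_const
        (continuous_snd.sub ((B.continuous_norm.comp continuous_fst).pow 2))
    filter_upwards [hu.eventually_exists _ (Filter.inter_mem (hopen.mem_nhds hus)
      (prod_mem_nhds hW Filter.univ_mem))]
    rintro y ⟨v, t, hv, ht, hvW, -⟩
    exact ⟨v, hfδ y v t hv ht, hvW⟩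
  · rw [eq_sub_iff_add_eq', ← sub_eq_zero, ← norm_le_zero_iff]
    refine le_of_forall_pos_le_add fun ε hε => ?_
    -- Two errors of at most `2 * (ε / 4)` each: one for `u`, one for its image, whose variance is
    -- the same.
    have hδ : 0 < ε / 4 := by positivity
    obtain ⟨u, s, hu, hus⟩ := hex x _ (pow_pos hδ 2)
    obtain ⟨t, hv, ht⟩ := hu.exists_map γ
    have h1 := hf x _ hδ u s hu hus
    have h2 := hf y _ hδ _ t hv (by rwa [ht])
    have h3 : B.L γ (f x) + c.c γ - f y = (B.L γ u + c.c γ - f y) - B.L γ (u - f x) := by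
      rw [map_sub]
      abel
    rw [h3]
    have h4 := norm_sub_le (B.L γ u + c.c γ - f y) (B.L γ (u - f x))
    rw [LinearIsometry.norm_map] at h4
    linarith
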